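/- There exist universal constants $C_1,C_2>0$ such that the following holds. Let $n\ge 1$, and let $K\subset\mathbb{R}^n$ be a centrally-symmetric convex body, i.e. a compact convex set with non-empty interior and $K=-K$; let $\|\cdot\|_K$ be the norm on $\mathbb{R}^n$ with unit ball $K$. Suppose that $K$ is $2$-convex with constant $\alpha>0$, i.e. that for all $0<\varepsilon\le 2$, \[ \inf\left\{1-\left\|\frac{x+y}{2}\right\|_K \; ; \; \|x\|_K,\|y\|_K\le 1,\ \|x-y\|_K\ge\varepsilon\right\}\ \ge\ \alpha\,\varepsilon^2 . \] Then for every $\theta$ in the Euclidean unit sphere $S^{n-1}$, \[ C_1\,\frac{\|\theta\|_K^*}{\sqrt n}\ \le\ \|\langle\cdot,\theta\rangle\|_{L_{\psi_2}(K)}\ \le\ C_2\,\frac{\|\theta\|_K^*}{\sqrt{\alpha}\,\sqrt n}, \] where $\|\theta\|_K^*=\sup_{y\in K}\langle\theta,y\rangle$ and \[ \|\langle\cdot,\theta\rangle\|_{L_{\psi_2}(K)}=\inf\left\{\lambda>0\; ;\; \frac{1}{|K|}\int_K e^{\langle x,\theta\rangle^2/\lambda^2}\,dx\le 2\right\}, \]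 with $|K|$ the volume of $K$. -/

import Mathlib

open MeasureTheory

noncomputable section

/-- The modulus of convexity of `K`: for `0 < ε ≤ 2`,
`δ_K(ε) = inf {1 - ‖(x+y)/2‖_K ; ‖x‖_K ≤ 1, ‖y‖_K ≤ 1, ‖x-y‖_K ≥ ε}`,
where `‖·‖_K = gauge K` is the norm with unit ball `K`. -/
def modulusOfConvexity {E : Type*} [AddCommGroup E] [Module ℝ E] (K : Set E) (ε : ℝ) : ℝ :=
  sInf {r : ℝ | ∃ x y : E, gauge K x ≤ 1 ∧ gauge K y ≤ 1 ∧ ε ≤ gauge K (x - y) ∧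
    r = 1 - gauge K ((1 / 2 : ℝ) • (x + y))}

/-- `K` is 2-convex with constant `α`: `δ_K(ε) ≥ α ε²` for all `0 < ε ≤ 2`. -/
def IsTwoConvexWith {E : Type*} [AddCommGroup E] [Module ℝ E] (K : Set E) (α : ℝ) : Prop :=
  ∀ ε : ℝ, 0 < ε → ε ≤ 2 → α * ε ^ 2 ≤ modulusOfConvexity K ε

/-- The dual norm `‖θ‖_K^* = sup_{y ∈ K} ⟨θ, y⟩` (the support function of `K`). -/
def dualNorm {E : Type*} [NormedAddCommGroup E] [InnerProductSpace ℝ E]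
    (K : Set E) (θ : E) : ℝ :=
  sSup ((fun y : E => inner ℝ θ y) '' K)

/-- The `ψ₂`-norm of the functional `⟨·, θ⟩` with respect to the uniform measure on `K`. -/
def psiTwoNorm {n : ℕ} (K : Set (EuclideanSpace ℝ (Fin n)))
    (θ : EuclideanSpace ℝ (Fin n)) : ℝ :=
  sInf {l : ℝ | 0 < l ∧
    1 / volume.real K * ∫ x in K, Real.exp ((inner ℝ x θ) ^ 2 / l ^ 2) ≤ 2}

end

/-! Upper bound: let `A` be the cap of `K` where `⟨x, θ⟩ ≥ t‖θ‖*`. For `x, y ∈ A` the points `x` and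
`-y` of `K` are at distance at least `2t`, so 2-convexity puts `(x - y)/2` in `(1 - 4αt²)K ⊆
exp(-4αt²)K`. Brunn–Minkowski gives `|A| ≤ |(A - A)/2|`, hence `|A| ≤ exp(-4αnt²)|K|`
(`volume_inner_ge_le`). Integrating this Gaussian tail bounds the exponential moment
(`lintegral_exp_sq_inner_le`). Lower bound: shrinking half of `K` by a factor 2 towards a maximiser
of `⟨·, θ⟩` shows that `⟨x, θ⟩ ≥ ‖θ‖*/2` on a proportion at least `2^(-n-1)` of `K`, which forces `λ
≥ ‖θ‖*/(3√n)`. Brunn–Minkowski itself comes from the midpoint Prékopa–Leindler inequality, proved on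
the line and then tensorized. -/

/-! ### Brunn–Minkowski on the line -/

/-- The one-dimensional Brunn–Minkowski inequality for compact sets. -/
theorem volume_add_volume_le_of_isCompact {P Q C : Set ℝ} (hP : IsCompact P) (hQ : IsCompact Q)
    (hP0 : P.Nonempty) (hQ0 : Q.Nonempty) (hC : ∀ x ∈ P, ∀ y ∈ Q, x + y ∈ C) :
    volume P + volume Q ≤ volume C := by
  -- With `p = max P` and `q = min Q`, the translates `P + q` and `p + Q` lie in `P + Q` and meet
  -- only at `p + q`.
  obtain ⟨p, hp, hpm⟩ := hP.exists_isGreatest hP0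
  obtain ⟨q, hq, hqm⟩ := hQ.exists_isLeast hQ0
  have h1 : volume P = volume ((fun x => x + q) '' P) := by
    rw [Set.image_add_right, measure_preimage_add_right]
  have h2 : volume Q = volume ((fun x => p + x) '' Q) := by
    rw [Set.image_add_left, measure_preimage_add]
  rw [h1, h2, ← measure_union₀]
  · apply measure_mono
    rintro z (⟨x, hx, rfl⟩ | ⟨y, hy, rfl⟩)
    · exact hC x hx q hq
    · exact hC p hp y hy
  · exact ((hQ.image (by fun_prop)).measurableSet).nullMeasurableSet
  · refine measure_mono_null (t := {p + q}) ?_ (by simp)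
    rintro z ⟨⟨x, hx, rfl⟩, ⟨y, hy, hxy⟩⟩
    have := hpm hx
    have := hqm hy
    simp only [Set.mem_singleton_iff] at *
    linarith

/-- The one-dimensional Brunn–Minkowski inequality. -/
theorem volume_add_volume_le {A B C : Set ℝ} (hA : MeasurableSet A) (hB : MeasurableSet B)
    (hA0 : A.Nonempty) (hB0 : B.Nonempty) (hC : ∀ x ∈ A, ∀ y ∈ B, x + y ∈ C) :
    volume A + volume B ≤ volume C := by
  obtain ⟨a, ha⟩ := hA0
  obtain ⟨b, hb⟩ := hB0
  rw [hA.measure_eq_iSup_isCompact, hB.measure_eq_iSup_isCompact]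
  simp only [iSup_and']
  refine ENNReal.biSup_add_biSup_le' ⟨∅, by simp⟩ ⟨∅, by simp⟩ ?_
  rintro P ⟨hPA, hP⟩ Q ⟨hQB, hQ⟩
  -- The compact sets of inner regularity may be empty; adding `a` and `b` makes them nonempty.
  calc volume P + volume Q ≤ volume (insert a P) + volume (insert b Q) := by
        gcongr <;> exact Set.subset_insert _ _
    _ ≤ volume C := volume_add_volume_le_of_isCompact (hP.insert a) (hQ.insert b)
        (Set.insert_nonempty _ _) (Set.insert_nonempty _ _)
        fun x hx y hy => hC x (Set.insert_subset ha hPA hx) y (Set.insert_subset hb hQB hy)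

/-! ### The Prékopa–Leindler inequality -/

/-- A measure satisfies the midpoint Prékopa–Leindler inequality. -/
def MidpointPrekopaLeindler {E : Type*} [AddCommGroup E] [Module ℝ E] [MeasurableSpace E]
    (μ : Measure E) : Prop :=
  ∀ f g h : E → ENNReal, Measurable f → Measurable g → Measurable h →
    (∀ x y, f x * g y ≤ h ((1 / 2 : ℝ) • (x + y)) ^ 2) →
    (∫⁻ x, f x ∂μ) * (∫⁻ x, g x ∂μ) ≤ (∫⁻ x, h x ∂μ) ^ 2

theorem ENNReal.mul_le_sq_of_add_le_two_mul {a b c : ENNReal} (h : a + b ≤ 2 * c) :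
    a * b ≤ c ^ 2 := by
  rcases eq_or_ne c ⊤ with rfl | hc
  · simp
  have hab : a + b ≠ ⊤ := ne_top_of_le_ne_top (ENNReal.mul_ne_top (by simp) hc) h
  rw [ENNReal.add_ne_top] at hab
  lift a to NNReal using hab.1
  lift b to NNReal using hab.2
  lift c to NNReal using hc
  norm_cast at h ⊢
  rw [← NNReal.coe_le_coe] at h ⊢
  push_cast at h ⊢
  nlinarith [sq_nonneg ((a : ℝ) - b), a.2, b.2, c.2]

open scoped Pointwise in
/-- The additive Prékopa–Leindler inequality on the line, for functions with supremum `1`. -/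
theorem lintegral_add_lintegral_le_of_sup_eq_one {F G H : ℝ → ℝ} (hF : Measurable F)
    (hG : Measurable G) (hH : Measurable H) (hF0 : ∀ x, 0 ≤ F x) (hG0 : ∀ x, 0 ≤ G x)
    (hH0 : ∀ x, 0 ≤ H x) (hF1 : ∀ x, F x ≤ 1) (hG1 : ∀ x, G x ≤ 1)
    (hFs : ∀ t, 0 ≤ t → t < 1 → ∃ x, t < F x) (hGs : ∀ t, 0 ≤ t → t < 1 → ∃ x, t < G x)
    (hFG : ∀ x y, F x * G y ≤ H ((1 / 2 : ℝ) • (x + y)) ^ 2) :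
    (∫⁻ x, ENNReal.ofReal (F x)) + ∫⁻ x, ENNReal.ofReal (G x)
      ≤ 2 * ∫⁻ x, ENNReal.ofReal (H x) := by
  rw [lintegral_eq_lintegral_meas_lt _ (.of_forall hF0) hF.aemeasurable,
    lintegral_eq_lintegral_meas_lt _ (.of_forall hG0) hG.aemeasurable,
    lintegral_eq_lintegral_meas_lt _ (.of_forall hH0) hH.aemeasurable,
    ← lintegral_const_mul' _ _ (by simp), ← lintegral_add_left]
  · refine setLIntegral_mono' measurableSet_Ioi fun t ht => ?_
    rcases lt_or_ge t 1 with h1 | h1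
    -- If `F x` and `G y` exceed `t`, then `H² > t²` at the midpoint: the level sets satisfy `{F >
    -- t} + {G > t} ⊆ 2{H > t}`.
    · have key := volume_add_volume_le (A := {x | t < F x}) (B := {x | t < G x})
        (C := (2 : ℝ) • {x | t < H x}) (measurableSet_lt measurable_const hF)
        (measurableSet_lt measurable_const hG) (hFs t (le_of_lt ht) h1)
        (hGs t (le_of_lt ht) h1) (by
          intro x hx y hy
          refine ⟨(1 / 2 : ℝ) • (x + y), ?_, by simp⟩
          have hx : t < F x := hx
          have hy : t < G y := hy
          have ht : 0 < t := ht
          have := hFG x y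
          have : t ^ 2 < H ((1 / 2 : ℝ) • (x + y)) ^ 2 := by nlinarith
          exact lt_of_pow_lt_pow_left₀ 2 (hH0 _) this)
      rw [Measure.addHaar_smul] at key
      simpa using key
    · have e1 : {x | t < F x} = ∅ := by
        ext x; simpa using (hF1 x).trans h1
      have e2 : {x | t < G x} = ∅ := by
        ext x; simpa using (hG1 x).trans h1
      rw [e1, e2]
      simp
  · exact Antitone.measurable fun s t hst => measure_mono fun x hx => lt_of_le_of_lt hst hx

/-- The inequality is homogeneous, so `f` and `g` may be scaled to supremum 1 and `h` by the
geometric mean of the two factors. The additive inequality then implies the product form by AM–GM.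
-/
theorem lintegral_mul_lintegral_le_of_bounded {f g h : ℝ → ENNReal} (hf : Measurable f)
    (hg : Measurable g) (hh : Measurable h) (hfb : ⨆ x, f x ≠ ⊤) (hgb : ⨆ x, g x ≠ ⊤)
    (hfg : ∀ x y, f x * g y ≤ h ((1 / 2 : ℝ) • (x + y)) ^ 2) :
    (∫⁻ x, f x) * (∫⁻ x, g x) ≤ (∫⁻ x, h x) ^ 2 := by
  set a := ⨆ x, f x with ha
  set b := ⨆ x, g x with hb
  have hfa (x) : f x ≤ a := le_iSup f x
  have hgb' (x) : g x ≤ b := le_iSup g x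
  rcases eq_or_ne a 0 with ha0 | ha0
  · have : ∀ x, f x = 0 := fun x => by simpa [ha0] using hfa x
    simp [this]
  rcases eq_or_ne b 0 with hb0 | hb0
  · have : ∀ x, g x = 0 := fun x => by simpa [hb0] using hgb' x
    simp [this]
  obtain ⟨c, hc⟩ : ∃ c : ENNReal, c ^ 2 = a * b :=
    ⟨(a * b) ^ (1 / 2 : ℝ), by rw [← ENNReal.rpow_natCast, ← ENNReal.rpow_mul]; simp⟩
  have hc0 : c ≠ 0 := by
    rintro rfl
    simp [ha0, hb0, eq_comm] at hc
  have hct : c ≠ ⊤ := by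
    rintro rfl
    exact ENNReal.mul_ne_top hfb hgb (by simpa using hc.symm)
  have scale {u : ℝ → ENNReal} {m : ENNReal} (hu : Measurable u) (hm : m ≠ 0) (hmt : m ≠ ⊤) :
      ∫⁻ x, u x = m * ∫⁻ x, u x / m := by
    rw [← lintegral_const_mul _ (hu.div_const m)]
    simp only [ENNReal.mul_div_cancel hm hmt]
  have nt {u m : ENNReal} (hm : m ≠ 0) (hum : u ≤ m) : u / m ≤ 1 :=
    ENNReal.div_le_of_le_mul (by simpa using hum)
  have sup_one {u : ℝ → ENNReal} {m : ENNReal} (hm : m ≠ 0) (hmt : m ≠ ⊤) (hum : ⨆ x, u x = m)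
      (t : ℝ) (ht0 : 0 ≤ t) (ht : t < 1) : ∃ x, t < (u x / m).toReal := by
    have hlt : ENNReal.ofReal t * m < ⨆ x, u x := by
      rw [hum]
      calc ENNReal.ofReal t * m < 1 * m :=
            ENNReal.mul_lt_mul_left hm hmt (by simpa using ht)
        _ = m := one_mul m
    obtain ⟨x, hx⟩ := lt_iSup_iff.1 hlt
    refine ⟨x, ?_⟩
    have h1 : u x / m ≤ 1 := nt hm (hum ▸ le_iSup u x)
    rw [← ENNReal.ofReal_lt_iff_lt_toReal ht0 (ne_top_of_le_ne_top (by simp) h1)]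
    exact (ENNReal.lt_div_iff_mul_lt (.inl hm) (.inl hmt)).2 hx
  -- Capping `h / c` at 1 keeps it finite under `toReal`; the hypothesis survives because `f / a`
  -- and `g / b` are at most 1.
  have key := lintegral_add_lintegral_le_of_sup_eq_one
    (F := fun x => (f x / a).toReal) (G := fun x => (g x / b).toReal)
    (H := fun x => (min (h x / c) 1).toReal) (hf.div_const a).ennreal_toReal
    (hg.div_const b).ennreal_toReal ((hh.div_const c).min measurable_const).ennreal_toReal
    (fun _ => ENNReal.toReal_nonneg) (fun _ => ENNReal.toReal_nonneg)
    (fun _ => ENNReal.toReal_nonneg)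
    (fun x => ENNReal.toReal_mono (by simp) (nt ha0 (hfa x)))
    (fun x => ENNReal.toReal_mono (by simp) (nt hb0 (hgb' x)))
    (sup_one ha0 hfb rfl) (sup_one hb0 hgb rfl) (by
      intro x y
      rw [← ENNReal.toReal_mul, ← ENNReal.toReal_pow]
      refine ENNReal.toReal_mono (ENNReal.pow_ne_top
        (ne_top_of_le_ne_top ENNReal.one_ne_top (min_le_right _ _))) ?_
      rcases le_total (h ((1 / 2 : ℝ) • (x + y)) / c) 1 with h1 | h1
      · rw [min_eq_left h1, div_eq_mul_inv _ c, mul_pow, ← ENNReal.inv_pow, hc, ← div_eq_mul_inv,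
           ← ENNReal.mul_div_mul_comm (.inl ha0) (.inl hfb)]
        gcongr
        exact hfg x y
      · rw [min_eq_right h1, one_pow]
        exact mul_le_one' (nt ha0 (hfa x)) (nt hb0 (hgb' y)))
  rw [scale hf ha0 hfb, scale hg hb0 hgb, scale hh hc0 hct, mul_mul_mul_comm, mul_pow, hc]
  gcongr
  refine ENNReal.mul_le_sq_of_add_le_two_mul (le_trans (le_of_eq ?_) (key.trans ?_))
  · congr 2 with x
    · rw [ENNReal.ofReal_toReal (ne_top_of_le_ne_top (by simp) (nt ha0 (hfa x)))]
    · rw [ENNReal.ofReal_toReal (ne_top_of_le_ne_top (by simp) (nt hb0 (hgb' x)))]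
  · gcongr with x
    exact ENNReal.ofReal_toReal_le.trans (min_le_left _ _)

theorem midpointPrekopaLeindler_real : MidpointPrekopaLeindler (volume : Measure ℝ) := by
  intro f g h hf hg hh hfg
  have trunc (f : ℝ → ENNReal) (hf : Measurable f) :
      ∫⁻ x, f x = ⨆ N : ℕ, ∫⁻ x, min (f x) N := by
    rw [← lintegral_iSup (fun N => hf.min measurable_const)]
    · congr with x
      rw [← inf_iSup_eq, ENNReal.iSup_natCast, inf_top_eq]
    · intro N M hNM x
      exact min_le_min le_rfl (by exact_mod_cast hNM)
  have bdd (f : ℝ → ENNReal) (N : ℕ) : ⨆ x, min (f x) N ≠ ⊤ :=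
    ne_top_of_le_ne_top (ENNReal.natCast_ne_top N) (iSup_le fun x => min_le_right _ _)
  rw [trunc f hf, trunc g hg]
  simp only [ENNReal.iSup_mul, ENNReal.mul_iSup]
  refine iSup_le fun N => iSup_le fun M => ?_
  refine lintegral_mul_lintegral_le_of_bounded (hf.min measurable_const) (hg.min measurable_const)
    hh (bdd f _) (bdd g _) fun x y => le_trans ?_ (hfg x y)
  gcongr <;> exact min_le_left _ _

/-- Tensorization: the inequality for `ν` on fibres is exactly the hypothesis of the inequality for
`μ` applied to the fibre integrals. -/
theorem MidpointPrekopaLeindler.prod {E F : Type*} [AddCommGroup E] [Module ℝ E]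
    [MeasurableSpace E] [AddCommGroup F] [Module ℝ F] [MeasurableSpace F] {μ : Measure E}
    {ν : Measure F} [SFinite ν] (hμ : MidpointPrekopaLeindler μ)
    (hν : MidpointPrekopaLeindler ν) : MidpointPrekopaLeindler (μ.prod ν) := by
  intro f g h hf hg hh hfg
  rw [lintegral_prod _ hf.aemeasurable, lintegral_prod _ hg.aemeasurable,
    lintegral_prod _ hh.aemeasurable]
  refine hμ _ _ _ hf.lintegral_prod_right' hg.lintegral_prod_right' hh.lintegral_prod_right'
    fun x y => ?_
  exact hν _ _ _ (hf.comp measurable_prodMk_left) (hg.comp measurable_prodMk_left)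
    (hh.comp measurable_prodMk_left) fun u v => hfg (x, u) (y, v)

theorem MidpointPrekopaLeindler.of_measurePreserving {E F : Type*} [AddCommGroup E] [Module ℝ E]
    [MeasurableSpace E] [AddCommGroup F] [Module ℝ F] [MeasurableSpace F] {μ : Measure E}
    {ν : Measure F} (hμ : MidpointPrekopaLeindler μ) (e : E →ₗ[ℝ] F)
    (he : MeasurePreserving e μ ν) : MidpointPrekopaLeindler ν := by
  intro f g h hf hg hh hfg
  rw [← he.lintegral_comp hf, ← he.lintegral_comp hg, ← he.lintegral_comp hh]
  refine hμ _ _ _ (hf.comp he.measurable) (hg.comp he.measurable) (hh.comp he.measurable)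
    fun x y => ?_
  simpa using hfg (e x) (e y)

theorem midpointPrekopaLeindler_pi :
    ∀ n : ℕ, MidpointPrekopaLeindler (volume : Measure (Fin n → ℝ))
  | 0 => by
    intro f g h _ _ _ hfg
    rw [Measure.volume_pi_eq_dirac (0 : Fin 0 → ℝ)]
    simp only [lintegral_dirac]
    convert hfg 0 0
  | n + 1 => by
    have h := midpointPrekopaLeindler_real.prod (midpointPrekopaLeindler_pi n)
    refine h.of_measurePreserving (Fin.consLinearEquiv ℝ (fun _ : Fin (n + 1) => ℝ)).toLinearMap ?_
    -- One map in two guises: the first is linear, the second is known to preserve volume.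
    have e : ⇑(Fin.consLinearEquiv ℝ (fun _ : Fin (n + 1) => ℝ)).toLinearMap
        = (MeasurableEquiv.piFinSuccAbove (fun _ : Fin (n + 1) => ℝ) 0).symm := by
      ext x : 1
      exact (Fin.insertNth_zero' x.1 x.2).symm
    rw [e]
    exact (volume_preserving_piFinSuccAbove (fun _ : Fin (n + 1) => ℝ) 0).symm

theorem midpointPrekopaLeindler_euclideanSpace (n : ℕ) :
    MidpointPrekopaLeindler (volume : Measure (EuclideanSpace ℝ (Fin n))) :=
  (midpointPrekopaLeindler_pi n).of_measurePreserving
    (WithLp.linearEquiv 2 ℝ (Fin n → ℝ)).symm.toLinearMap (PiLp.volume_preserving_toLp (Fin n))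

/-! ### Gaussian decay of caps and the upper bound -/

/-- Multiplicative Brunn–Minkowski for `A` and `-A`, which have equal volume: Prékopa–Leindler
applied to indicators. -/
theorem volume_le_of_half_sub_mem {n : ℕ} {A M : Set (EuclideanSpace ℝ (Fin n))}
    (hA : MeasurableSet A) (hM : MeasurableSet M)
    (h : ∀ x ∈ A, ∀ y ∈ A, (1 / 2 : ℝ) • (x - y) ∈ M) : volume A ≤ volume M := by
  have key := midpointPrekopaLeindler_euclideanSpace n (A.indicator 1)
    ((-A).indicator 1) (M.indicator 1) (measurable_one.indicator hA)
    (measurable_one.indicator hA.neg) (measurable_one.indicator hM) (by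
      intro x y
      by_cases hx : x ∈ A
      · by_cases hy : y ∈ -A
        · have := h x hx (-y) hy
          rw [sub_neg_eq_add] at this
          rw [Set.indicator_of_mem this]
          simp [hx, hy]
        · simp [Set.indicator_of_notMem hy]
      · simp [hx])
  rw [lintegral_indicator_one hA, lintegral_indicator_one hA.neg, lintegral_indicator_one hM,
    Measure.measure_neg, ← sq] at key
  exact (ENNReal.pow_le_pow_left_iff two_ne_zero).1 key

theorem inner_le_dualNorm_mul_gauge {n : ℕ} {K : Set (EuclideanSpace ℝ (Fin n))}
    (hK : IsCompact K) (hK0 : K ∈ nhds 0) (θ z : EuclideanSpace ℝ (Fin n)) :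
    inner ℝ θ z ≤ dualNorm K θ * gauge K z := by
  have hbdd : BddAbove ((fun y => inner ℝ θ y) '' K) :=
    (hK.image (by fun_prop)).bddAbove
  have h0 : 0 ≤ dualNorm K θ :=
    le_csSup hbdd ⟨0, mem_of_mem_nhds hK0, by simp⟩
  -- For `a` above the gauge, `z` is a multiple `b • y` with `y ∈ K` and `b < a`; then `a` decreases
  -- to the gauge.
  have step : ∀ a, gauge K z < a → inner ℝ θ z ≤ dualNorm K θ * a := by
    intro a ha
    obtain ⟨b, hb, hba, y, hy, rfl⟩ := exists_lt_of_gauge_lt (absorbent_nhds_zero hK0) ha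
    have : inner ℝ θ y ≤ dualNorm K θ := le_csSup hbdd ⟨y, hy, rfl⟩
    simp only [inner_smul_right]
    nlinarith
  refine ge_of_tendsto (x := nhdsWithin (gauge K z) (Set.Ioi (gauge K z)))
    (f := fun a => dualNorm K θ * a) ?_ ?_
  · exact ((continuous_const.mul continuous_id).tendsto _).mono_left nhdsWithin_le_nhds
  · filter_upwards [self_mem_nhdsWithin] with a ha using step a ha

theorem gauge_half_add_le {E : Type*} [AddCommGroup E] [Module ℝ E] {K : Set E} {α ε : ℝ}
    (hc : Convex ℝ K) (ha : Absorbent ℝ K) (hα : IsTwoConvexWith K α) (hε : 0 < ε) {x y : E}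
    (hx : gauge K x ≤ 1) (hy : gauge K y ≤ 1) (hε2 : ε ≤ 2) (hxy : ε ≤ gauge K (x - y)) :
    gauge K ((1 / 2 : ℝ) • (x + y)) ≤ 1 - α * ε ^ 2 := by
  have h1 := hα ε hε hε2
  have h2 : modulusOfConvexity K ε ≤ 1 - gauge K ((1 / 2 : ℝ) • (x + y)) := by
    -- A real `sInf` is a lower bound only for a set bounded below; the triangle inequality supplies
    -- the bound 0.
    refine csInf_le ⟨0, ?_⟩ ⟨x, y, hx, hy, hxy, rfl⟩
    rintro r ⟨u, v, hu, hv, -, rfl⟩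
    rw [gauge_smul_of_nonneg (by norm_num), smul_eq_mul]
    linarith [gauge_add_le hc ha u v]
  linarith

open scoped Pointwise in
theorem volume_inner_ge_le {n : ℕ} {K : Set (EuclideanSpace ℝ (Fin n))} {α t : ℝ}
    {θ : EuclideanSpace ℝ (Fin n)}
    (hc : Convex ℝ K) (hK : IsCompact K) (hK0 : K ∈ nhds 0) (hs : ∀ x ∈ K, -x ∈ K)
    (hα : IsTwoConvexWith K α) (hθ : 0 < dualNorm K θ) (ht : 0 < t) :
    volume {x ∈ K | t * dualNorm K θ ≤ inner ℝ x θ}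
      ≤ ENNReal.ofReal (Real.exp (-(4 * (α * n * t ^ 2)))) * volume K := by
  have hab : Absorbent ℝ K := absorbent_nhds_zero hK0
  set r := Real.exp (-(4 * (α * t ^ 2))) with hr
  have hr0 : 0 < r := Real.exp_pos _
  have hsub : ∀ x ∈ {x ∈ K | t * dualNorm K θ ≤ inner ℝ x θ},
      ∀ y ∈ {x ∈ K | t * dualNorm K θ ≤ inner ℝ x θ}, (1 / 2 : ℝ) • (x - y) ∈ r • K := by
    rintro x ⟨hx, hxt⟩ y ⟨hy, hyt⟩
    have gx := gauge_le_one_of_mem hx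
    have gy := gauge_le_one_of_mem (hs y hy)
    have h2 : 2 * t ≤ gauge K (x - -y) := by
      have := inner_le_dualNorm_mul_gauge hK hK0 θ (x - -y)
      rw [real_inner_comm, sub_neg_eq_add, inner_add_left] at this
      rw [sub_neg_eq_add]
      nlinarith
    -- 2-convexity concerns only `ε ≤ 2`; a point in the cap already forces `t ≤ 1`.
    have h3 : 2 * t ≤ 2 := by
      have := gauge_add_le hc hab x y
      rw [sub_neg_eq_add] at h2
      linarith [gauge_le_one_of_mem hy]
    have h4 := gauge_half_add_le hc hab hα (by positivity) gx gy h3 h2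
    rw [← sub_eq_add_neg] at h4
    have h5 : gauge K ((1 / 2 : ℝ) • (x - y)) ≤ r := by
      have := Real.add_one_le_exp (-(4 * (α * t ^ 2)))
      rw [← hr] at this
      nlinarith
    rw [Set.mem_smul_set_iff_inv_smul_mem₀ hr0.ne', ← hK.isClosed.closure_eq,
      ← gauge_le_one_iff_mem_closure hc hK0, gauge_smul_of_nonneg (by positivity), smul_eq_mul]
    rw [inv_mul_le_one₀ hr0]
    exact h5
  refine (volume_le_of_half_sub_mem ?_ (hK.smul r).measurableSet hsub).trans ?_
  · exact hK.measurableSet.inter (measurableSet_le measurable_const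
      (by fun_prop : Measurable fun x => inner ℝ x θ))
  · rw [Measure.addHaar_smul, finrank_euclideanSpace_fin, abs_of_pos (by positivity), hr,
      ← Real.exp_nat_mul]
    apply le_of_eq
    ring_nf

theorem volume_sq_inner_ge_le {n : ℕ} {K : Set (EuclideanSpace ℝ (Fin n))} {α s : ℝ}
    {θ : EuclideanSpace ℝ (Fin n)}
    (hc : Convex ℝ K) (hK : IsCompact K) (hK0 : K ∈ nhds 0) (hs : ∀ x ∈ K, -x ∈ K)
    (hα : IsTwoConvexWith K α) (hθ : 0 < dualNorm K θ) (ht : 0 < s) :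
    volume {x ∈ K | s ≤ (inner ℝ x θ / dualNorm K θ) ^ 2}
      ≤ ENNReal.ofReal (2 * Real.exp (-(4 * (α * n * s)))) * volume K := by
  have key := volume_inner_ge_le hc hK hK0 hs hα hθ (Real.sqrt_pos.2 ht)
  rw [Real.sq_sqrt ht.le] at key
  set A := {x ∈ K | √s * dualNorm K θ ≤ inner ℝ x θ}
  have hsub : {x ∈ K | s ≤ (inner ℝ x θ / dualNorm K θ) ^ 2} ⊆ A ∪ -A := by
    rintro x ⟨hx, hxs⟩
    have : √s ≤ |inner ℝ x θ / dualNorm K θ| := Real.sqrt_le_iff.2 ⟨abs_nonneg _, by simpa⟩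
    rcases le_abs.1 this with h | h
    · exact .inl ⟨hx, (le_div_iff₀ hθ).1 h⟩
    · refine .inr ⟨hs x hx, ?_⟩
      rw [← neg_div, le_div_iff₀ hθ] at h
      simpa using h
  calc _ ≤ volume (A ∪ -A) := measure_mono hsub
    _ ≤ volume A + volume (-A) := measure_union_le _ _
    _ = 2 * volume A := by rw [Measure.measure_neg, two_mul]
    _ ≤ 2 * (ENNReal.ofReal (Real.exp (-(4 * (α * n * s)))) * volume K) := by gcongr
    _ = _ := by rw [ENNReal.ofReal_mul (by norm_num), ← mul_assoc]; simp

/-- Layer cake for `exp(cX) - 1` with `c = αn`. The tail `2 exp(-4ct)` against the density `c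
exp(ct)` leaves `∫ 2c exp(-3ct) dt = 2/3 ≤ 1`, so the total is at most `2|K|`. -/
theorem lintegral_exp_sq_inner_le {n : ℕ} {K : Set (EuclideanSpace ℝ (Fin n))} {α : ℝ}
    {θ : EuclideanSpace ℝ (Fin n)} (hn : 0 < n)
    (hc : Convex ℝ K) (hK : IsCompact K) (hK0 : K ∈ nhds 0) (hs : ∀ x ∈ K, -x ∈ K)
    (hα0 : 0 < α) (hα : IsTwoConvexWith K α) (hθ : 0 < dualNorm K θ) :
    ∫⁻ x in K, ENNReal.ofReal (Real.exp (α * n * (inner ℝ x θ / dualNorm K θ) ^ 2))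
      ≤ 2 * volume K := by
  set c := α * n with hcdef
  have hc0 : 0 < c := by positivity
  have hint (u : ℝ) : ∫ t in (0 : ℝ)..u, c * Real.exp (c * t) = Real.exp (c * u) - 1 := by
    rw [intervalIntegral.integral_eq_sub_of_hasDerivAt (f := fun t => Real.exp (c * t))]
    · simp
    · intro x _
      simpa [mul_comm] using ((hasDerivAt_id x).const_mul c).exp
    · exact Continuous.intervalIntegrable (by fun_prop) _ _
  have layer := lintegral_comp_eq_lintegral_meas_le_mul (volume.restrict K)
    (f := fun x => (inner ℝ x θ / dualNorm K θ) ^ 2) (g := fun t => c * Real.exp (c * t))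
    (.of_forall fun x => by positivity) (by fun_prop)
    (fun t _ => Continuous.intervalIntegrable (by fun_prop) _ _)
    (.of_forall fun t => by positivity)
  simp only [hint] at layer
  have tail : ∫⁻ t in Set.Ioi (0 : ℝ),
      volume.restrict K {x | t ≤ (inner ℝ x θ / dualNorm K θ) ^ 2}
        * ENNReal.ofReal (c * Real.exp (c * t)) ≤ volume K := by
    calc _ ≤ ∫⁻ t in Set.Ioi (0 : ℝ),
          volume K * ENNReal.ofReal (2 * c * Real.exp (-(3 * c) * t)) := by
          refine setLIntegral_mono' measurableSet_Ioi fun t ht => ?_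
          have h1 := volume_sq_inner_ge_le hc hK hK0 hs hα hθ ht
          rw [Measure.restrict_apply (measurableSet_le measurable_const (by fun_prop)),
            Set.inter_comm]
          calc _ ≤ ENNReal.ofReal (2 * Real.exp (-(4 * (α * n * t)))) * volume K
                * ENNReal.ofReal (c * Real.exp (c * t)) := by gcongr; exact h1
            _ = _ := by
              rw [mul_comm _ (volume K), mul_assoc, ← ENNReal.ofReal_mul (by positivity)]
              congr 2
              rw [mul_mul_mul_comm, ← Real.exp_add]
              congr 2
              rw [hcdef]
              ring
      _ = volume K * ENNReal.ofReal (∫ t in Set.Ioi (0 : ℝ), 2 * c * Real.exp (-(3 * c) * t)) := by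
          rw [lintegral_const_mul _ (by fun_prop), ofReal_integral_eq_lintegral_ofReal]
          · exact (integrableOn_exp_mul_Ioi (by linarith) 0).const_mul _
          · exact .of_forall fun t => by positivity
      _ ≤ volume K * 1 := by
          gcongr
          rw [integral_const_mul, integral_exp_mul_Ioi (by linarith)]
          simp only [mul_zero, Real.exp_zero, ENNReal.ofReal_le_one]
          rw [neg_div_neg_eq, mul_one_div, div_le_one (by positivity)]
          linarith
      _ = volume K := mul_one _
  calc _ = ∫⁻ x in K, (1 + ENNReal.ofReal
          (Real.exp (c * (inner ℝ x θ / dualNorm K θ) ^ 2) - 1)) := by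
        congr with x
        rw [← ENNReal.ofReal_one, ← ENNReal.ofReal_add zero_le_one]
        · simp
        · simpa using by positivity
    _ = volume K + ∫⁻ x in K, ENNReal.ofReal
          (Real.exp (c * (inner ℝ x θ / dualNorm K θ) ^ 2) - 1) := by
        rw [lintegral_add_left measurable_const]
        simp
    _ ≤ volume K + volume K := by
        rw [layer]
        gcongr
    _ = 2 * volume K := (two_mul _).symm

/-! ### The lower bound -/

open scoped Pointwise in
theorem volume_le_volume_half_dualNorm_le_inner {n : ℕ} {K : Set (EuclideanSpace ℝ (Fin n))}
    (hc : Convex ℝ K) (hK : IsCompact K) (hK0 : K.Nonempty) (hs : ∀ x ∈ K, -x ∈ K)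
    (θ : EuclideanSpace ℝ (Fin n)) :
    volume K ≤ 2 * 2 ^ n * volume {x ∈ K | dualNorm K θ / 2 ≤ inner ℝ x θ} := by
  obtain ⟨y, hy, hyθ⟩ := hK.exists_sSup_image_eq hK0
    (f := fun y : EuclideanSpace ℝ (Fin n) => inner ℝ θ y) (by fun_prop)
  have hyθ : dualNorm K θ = inner ℝ θ y := hyθ
  set A := {x ∈ K | 0 ≤ inner ℝ x θ} with hA
  set T := {x ∈ K | dualNorm K θ / 2 ≤ inner ℝ x θ} with hT
  have h1 : volume K ≤ 2 * volume A := by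
    calc volume K ≤ volume (A ∪ -A) := by
          refine measure_mono fun x hx => ?_
          rcases le_total 0 (inner ℝ x θ) with h | h
          · exact .inl ⟨hx, h⟩
          · exact .inr ⟨hs x hx, by simpa using h⟩
      _ ≤ volume A + volume (-A) := measure_union_le _ _
      _ = 2 * volume A := by rw [Measure.measure_neg, two_mul]
  -- The translate `(A + y)/2` stays in `K` by convexity, and there the functional is at least half
  -- its maximum, attained at `y`.
  have h2 : volume ((1 / 2 : ℝ) • A) ≤ volume T := by
    rw [← measure_preimage_add volume (-((1 / 2 : ℝ) • y)), ← Set.image_add_left]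
    refine measure_mono ?_
    rintro _ ⟨_, ⟨x, ⟨hx, hxθ⟩, rfl⟩, rfl⟩
    refine ⟨hc hy hx (by norm_num) (by norm_num) (by norm_num), ?_⟩
    simp only [inner_add_left, inner_smul_left, hyθ, real_inner_comm y θ]
    simp
    linarith
  have h3 : volume A = 2 ^ n * volume ((1 / 2 : ℝ) • A) := by
    rw [Measure.addHaar_smul, finrank_euclideanSpace_fin, abs_of_pos (by positivity), ← mul_assoc]
    have : (2 : ENNReal) ^ n * ENNReal.ofReal ((1 / 2) ^ n) = 1 := by
      rw [show (2 : ENNReal) = ENNReal.ofReal 2 by simp, ← ENNReal.ofReal_pow (by norm_num),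
        ← ENNReal.ofReal_mul (by positivity), ← mul_pow]
      simp
    rw [this, one_mul]
  rw [mul_assoc]
  refine h1.trans ?_
  rw [h3]
  gcongr

/-- Markov's inequality on the cap `T`: `exp(‖θ‖*²/(4l²))|T| ≤ 2|K| ≤ 2^(n+2)|T|`, then logarithms.
-/
theorem dualNorm_le_of_integral_exp_le {n : ℕ} {K : Set (EuclideanSpace ℝ (Fin n))}
    (hn : 0 < n) (hc : Convex ℝ K) (hK : IsCompact K) (hK0 : (interior K).Nonempty)
    (hs : ∀ x ∈ K, -x ∈ K) {θ : EuclideanSpace ℝ (Fin n)} (hθ : 0 ≤ dualNorm K θ) {l : ℝ}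
    (hl : 0 < l)
    (h : 1 / volume.real K * ∫ x in K, Real.exp ((inner ℝ x θ) ^ 2 / l ^ 2) ≤ 2) :
    dualNorm K θ ≤ 3 * √n * l := by
  have hV : 0 < volume.real K := ENNReal.toReal_pos
    (Measure.measure_pos_of_nonempty_interior volume hK0).ne' hK.measure_lt_top.ne
  set T := {x ∈ K | dualNorm K θ / 2 ≤ inner ℝ x θ} with hT
  have hTK : T ⊆ K := Set.sep_subset _ _
  have hTm : MeasurableSet T :=
    hK.measurableSet.inter (measurableSet_le measurable_const
      (by fun_prop : Measurable fun x => inner ℝ x θ))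
  have hTt : volume T ≠ ⊤ := ne_top_of_le_ne_top hK.measure_lt_top.ne (measure_mono hTK)
  have hvol : volume.real K ≤ 2 * 2 ^ n * volume.real T := by
    have := volume_le_volume_half_dualNorm_le_inner hc hK (hK0.mono interior_subset) hs θ
    have := ENNReal.toReal_mono (by finiteness) this
    simpa [ENNReal.toReal_mul, measureReal_def] using this
  have hint : IntegrableOn (fun x => Real.exp ((inner ℝ x θ) ^ 2 / l ^ 2)) K volume :=
    ContinuousOn.integrableOn_compact hK (by fun_prop)
  have hlow : Real.exp ((dualNorm K θ / 2) ^ 2 / l ^ 2) * volume.real T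
      ≤ ∫ x in K, Real.exp ((inner ℝ x θ) ^ 2 / l ^ 2) := by
    refine (setIntegral_ge_of_const_le_real hTm hTt (fun x hx => ?_) (hint.mono_set hTK)).trans
      (setIntegral_mono_set hint (.of_forall fun x => (Real.exp_pos _).le)
        (LE.le.eventuallyLE hTK))
    have := hx.2
    gcongr
  rw [one_div, inv_mul_le_iff₀ hV] at h
  have hT0 : 0 < volume.real T := by
    by_contra hcon
    have : 2 * 2 ^ n * volume.real T ≤ 0 := mul_nonpos_of_nonneg_of_nonpos (by positivity)
      (not_lt.1 hcon)
    linarith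
  have hexp : Real.exp ((dualNorm K θ / 2) ^ 2 / l ^ 2) ≤ 2 ^ (n + 2) := by
    refine le_of_mul_le_mul_right ?_ hT0
    calc _ ≤ volume.real K * 2 := hlow.trans h
      _ ≤ 2 * 2 ^ n * volume.real T * 2 := by gcongr
      _ = _ := by ring
  have hlog := (Real.le_log_iff_exp_le (by positivity)).2 hexp
  rw [Real.log_pow] at hlog
  have hn1 : (1 : ℝ) ≤ n := by exact_mod_cast hn
  have hfin : (dualNorm K θ / 2) ^ 2 / l ^ 2 ≤ 9 / 4 * n := by
    have := Real.log_two_lt_d9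
    push_cast at hlog
    -- `log 2 < 3/4` and `n + 2 ≤ 3n` give `9n/4`, whose square root yields the factor 3 after
    -- clearing the half.
    have h3 : ((n : ℝ) + 2) * Real.log 2 ≤ (n + 2) * (3 / 4) := by gcongr; linarith
    linarith
  rw [div_le_iff₀ (by positivity)] at hfin
  refine abs_le_of_sq_le_sq' ?_ (by positivity) |>.2
  rw [mul_pow, mul_pow, Real.sq_sqrt (by positivity)]
  linarith

/-! ### Positivity and the two-sided estimate -/

theorem dualNorm_pos {n : ℕ} {K : Set (EuclideanSpace ℝ (Fin n))} (hK : IsCompact K)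
    (hK0 : K ∈ nhds 0) {θ : EuclideanSpace ℝ (Fin n)} (hθ : θ ≠ 0) : 0 < dualNorm K θ := by
  have h1 := inner_le_dualNorm_mul_gauge hK hK0 θ θ
  have h2 : 0 < inner ℝ θ θ := real_inner_self_pos.2 hθ
  by_contra hcon
  have := mul_nonpos_of_nonpos_of_nonneg (not_lt.1 hcon) (gauge_nonneg (s := K) θ)
  linarith

theorem Convex.mem_nhds_zero_of_symmetric {E : Type*} [NormedAddCommGroup E] [NormedSpace ℝ E]
    {K : Set E} (hc : Convex ℝ K) (hs : ∀ x ∈ K, -x ∈ K) (hK0 : (interior K).Nonempty) :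
    K ∈ nhds 0 := by
  obtain ⟨x, hx⟩ := hK0
  rw [← mem_interior_iff_mem_nhds]
  have := hc.combo_interior_self_mem_interior hx (hs x (interior_subset hx))
    (a := 1 / 2) (b := 1 / 2) (by norm_num) (by norm_num) (by norm_num)
  simpa using this

theorem mainTheorem9 :
    ∃ C₁ C₂ : ℝ, 0 < C₁ ∧ 0 < C₂ ∧
      ∀ (n : ℕ) (K : ConvexBody (EuclideanSpace ℝ (Fin n))) (α : ℝ),
        (interior (K : Set (EuclideanSpace ℝ (Fin n)))).Nonempty →
        (∀ x ∈ K, -x ∈ K) →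
        0 < α →
        IsTwoConvexWith (K : Set (EuclideanSpace ℝ (Fin n))) α →
        ∀ θ ∈ Metric.sphere (0 : EuclideanSpace ℝ (Fin n)) 1,
          C₁ * (dualNorm (K : Set (EuclideanSpace ℝ (Fin n))) θ / √(n : ℝ))
              ≤ psiTwoNorm (K : Set (EuclideanSpace ℝ (Fin n))) θ ∧
          psiTwoNorm (K : Set (EuclideanSpace ℝ (Fin n))) θ
              ≤ C₂ * (dualNorm (K : Set (EuclideanSpace ℝ (Fin n))) θ / (√α * √(n : ℝ))) := by
  refine ⟨1 / 3, 1, by norm_num, one_pos, fun n K α hint hsym hα htc θ hθ => ?_⟩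
  have hθ0 : θ ≠ 0 := Metric.ne_of_mem_sphere hθ one_ne_zero
  have hn : 0 < n := by
    rcases Nat.eq_zero_or_pos n with rfl | h
    · exact absurd (Subsingleton.elim θ 0) hθ0
    · exact h
  have hK := K.isCompact
  have hs : ∀ x ∈ (K : Set (EuclideanSpace ℝ (Fin n))), -x ∈ (K : Set _) := hsym
  have hK0 := K.convex.mem_nhds_zero_of_symmetric hs hint
  have hd := dualNorm_pos hK hK0 hθ0
  have hV : 0 < volume.real (K : Set (EuclideanSpace ℝ (Fin n))) := ENNReal.toReal_pos
    (Measure.measure_pos_of_nonempty_interior volume hint).ne' hK.measure_lt_top.ne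
  have hsn : 0 < √(n : ℝ) := by positivity
  have hsα : 0 < √α := by positivity
  -- The value `‖θ‖*/√(αn)` turns the exponent into `αn(⟨x, θ⟩/‖θ‖*)²`, so it is admissible and `C₂
  -- = 1` works.
  have hmem : dualNorm (K : Set (EuclideanSpace ℝ (Fin n))) θ / (√α * √(n : ℝ)) ∈
      {l : ℝ | 0 < l ∧ 1 / volume.real (K : Set (EuclideanSpace ℝ (Fin n))) *
        ∫ x in K, Real.exp ((inner ℝ x θ) ^ 2 / l ^ 2) ≤ 2} := by
    refine ⟨by positivity, ?_⟩
    rw [one_div, inv_mul_le_iff₀ hV, integral_eq_lintegral_of_nonneg_ae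
      (.of_forall fun x => (Real.exp_pos _).le) (by fun_prop)]
    have key := ENNReal.toReal_mono (ENNReal.mul_ne_top (by simp) hK.measure_lt_top.ne)
      (lintegral_exp_sq_inner_le hn K.convex hK hK0 hs hα htc hd)
    rw [ENNReal.toReal_mul] at key
    refine le_trans (le_of_eq ?_) (key.trans_eq (mul_comm _ _))
    congr! 5 with x
    rw [div_pow, mul_pow, Real.sq_sqrt hα.le, Real.sq_sqrt (by positivity)]
    field_simp
  constructor
  -- An admissible value is needed here too, since `sInf ∅ = 0` would break the lower bound.
  · refine le_csInf ⟨_, hmem⟩ ?_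
    rintro l ⟨hl, hle⟩
    have := dualNorm_le_of_integral_exp_le hn K.convex hK hint hs hd.le hl hle
    rw [one_div_mul_eq_div, div_le_iff₀ (by norm_num), div_le_iff₀ hsn]
    linarith
  · rw [one_mul]
    exact csInf_le ⟨0, fun l hl => hl.1.le⟩ hmem
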